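/- Let $k$ be an algebraically closed field of characteristic zero and let $X$ be an irreducible affine variety over $k$. A derivation $\partial$ of $k[X]$ (over $k$) is locally nilpotent if for every $a\in k[X]$ some power of $\partial$ kills $a$. The field Makar-Limanov invariant $\mathrm{FML}(X)\subseteq k(X)$ is the intersection of the kernels of the extensions to the field of fractions $k(X)$ of all locally nilpotent derivations of $k[X]$. Let $\mathrm{SAut}(X)$ be the subgroup of $\mathrm{Aut}(X)$ generated by the images of all regular actions $\mathbb G_a\times X\to X$ of the additive group $\mathbb G_a=(k,+)$. A $\mathbb G_a$-subgroup of $\mathrm{Aut}(X)$ is a subgroup $H$ with an isomorphism $\mathbb G_a\cong H$ for which the resulting action $\mathbb G_a\times X\to X$ is regular. Suppose that $\mathrm{FML}(X)=k$. Then: 1. $X$ is unirational, that is, for some $n\ge 0$ there is a dominant rational map $\mathbb A^n\dashrightarrow X$ over $k$. 2. $\mathrm{SAut}(X)$ has a Zariski open orbit $O\subseteq X$, and there are $s\ge 0$, $\mathbb G_a$-subgroups $H_1,\dots,H_s$ of $\mathrm{Aut}(X)$ (hence of $\mathrm{SAut}(X)$) and a point $x\in O$ such that $$O=\{(h_1\cdots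 h_s).x \;:\; h_i\in H_i\}.$$ Moreover, under the identification $\mathbb A^s\cong H_1\times\dots\times H_s$ given by the isomorphisms $\mathbb G_a\cong H_i$, the map $\mathbb A^s\to X$, $(h_1,\dots,h_s)\mapsto(h_1\cdots h_s).x$, is a morphism of varieties. 3. $O$ is $\mathbb A^1$-connected: any two points of $O$ lie in the image of one morphism $\mathbb A^1\to O$. -/

import Mathlib

/-!
Throughout, `k` is the ground field, `A` is the algebra `k[X]` of regular functions on an affine
variety `X = Spec A`, and a point of `X` is a `k`-algebra homomorphism `A →ₐ[k] k` (evaluation at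
the point).  Over an algebraically closed field the irreducible affine varieties are exactly the
spectra of the finitely generated `k`-algebras without zero divisors.
-/

universe u

namespace AffVar

open AlgebraicGeometry CategoryTheory

section MakarLimanov

variable (k A : Type u) [Field k] [CommRing A] [IsDomain A] [Algebra k A]

variable {k A} in
/-- A `k`-derivation `D` of `A` is locally nilpotent if every element is killed by a power
of `D`. -/
def IsLocallyNilpotent (D : Derivation k A A) : Prop :=
  ∀ a : A, ∃ m : ℕ, (⇑D)^[m] a = 0

variable {k A} in
/-- The derivation `E` of the field of fractions `k(X)` extends the derivation `D` of `k[X]`. -/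
def Extends (E : Derivation k (FractionRing A) (FractionRing A)) (D : Derivation k A A) : Prop :=
  ∀ a : A, E (algebraMap A (FractionRing A) a) = algebraMap A (FractionRing A) (D a)

variable {k A} in
/-- Every derivation of `k[X]` has exactly one extension to the field of fractions. -/
theorem existsUnique_extends (D : Derivation k A A) :
    ∃! E : Derivation k (FractionRing A) (FractionRing A), Extends E D := by
  let K := FractionRing A
  have hfe : Algebra.FormallyEtale A K :=
    Algebra.FormallyEtale.of_isLocalization (nonZeroDivisors A)
  let l : Ω[A⁄k] →ₗ[A] K :=
    (Algebra.linearMap A K).comp D.liftKaehlerDifferential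
  let e := KaehlerDifferential.tensorKaehlerEquivOfFormallyEtale k A K
  let L : Ω[K⁄k] →ₗ[K] K := (l.liftBaseChange K).comp e.symm.toLinearMap
  have hL : ∀ a : A, L (KaehlerDifferential.D k K (algebraMap A K a)) = algebraMap A K (D a) := by
    intro a
    have h1 : e.symm (KaehlerDifferential.D k K (algebraMap A K a))
        = 1 ⊗ₜ[A] KaehlerDifferential.D k A a := by
      rw [LinearEquiv.symm_apply_eq]
      change _ = KaehlerDifferential.mapBaseChange k A K _
      simp
    simp [L, h1, l]
  refine ⟨L.compDer (KaehlerDifferential.D k K), fun a => hL a, ?_⟩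
  intro E hE
  ext x
  obtain ⟨a, b, hb, rfl⟩ := IsFractionRing.div_surjective (A := A) x
  have hb0 : algebraMap A K b ≠ 0 := by
    simpa using nonZeroDivisors.ne_zero hb
  have key : ∀ F : Derivation k K K, (∀ c : A, F (algebraMap A K c) = algebraMap A K (D c)) →
      F (algebraMap A K a / algebraMap A K b) =
        (algebraMap A K (D a) - (algebraMap A K a / algebraMap A K b) * algebraMap A K (D b))
          / algebraMap A K b := by
    intro F hF
    have h := F.leibniz (algebraMap A K a / algebraMap A K b) (algebraMap A K b)
    rw [div_mul_cancel₀ _ hb0, hF, hF] at h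
    simp only [smul_eq_mul] at h
    rw [eq_div_iff hb0, h]
    ring
  exact (key E hE).trans (key _ (fun c => hL c)).symm

/-- The field Makar-Limanov invariant `FML(X)`: the intersection of the kernels of the extensions
to `k(X)` of all locally nilpotent derivations of `k[X]`, as a subfield of `k(X)` over `k`. -/
def FML : IntermediateField k (FractionRing A) where
  carrier := {f | ∀ D : Derivation k A A, IsLocallyNilpotent D →
    ∀ E : Derivation k (FractionRing A) (FractionRing A), Extends E D → E f = 0}
  mul_mem' := by
    intro f g hf hg D hD E hE
    simp [E.leibniz, hf D hD E hE, hg D hD E hE]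
  add_mem' := by
    intro f g hf hg D hD E hE
    simp [hf D hD E hE, hg D hD E hE]
  algebraMap_mem' := by
    intro c D hD E hE
    exact E.map_algebraMap c
  inv_mem' := by
    intro f hf D hD E hE
    simp [E.leibniz_inv, hf D hD E hE]

end MakarLimanov

section Points

variable {k A : Type u} [Field k] [CommRing A] [Algebra k A]

/-- A set of points of `X` is Zariski open if it is the set of points where at least one of some
family of regular functions does not vanish. -/
def IsZariskiOpen (U : Set (A →ₐ[k] k)) : Prop :=
  ∃ S : Set A, U = {x | ∃ f ∈ S, x f ≠ 0}

/-- The action of `Aut(X)` on the points of `X`.  The group `Aut(X)` is identified with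
`A ≃ₐ[k] A` so that `g` acts on `k[X]` by `(g⁻¹)^*`; hence `f (g x) = (g⁻¹ f) (x)`. -/
def act (g : A ≃ₐ[k] A) (x : A →ₐ[k] k) : A →ₐ[k] k :=
  x.comp (g⁻¹ : A ≃ₐ[k] A)

/-- An action of the additive group `G_a = (k, +)` on `X` by automorphisms is regular if the map
`G_a × X → X`, `(t, x) ↦ φ(t) x`, is a morphism, that is, if it is induced by a homomorphism
from `k[X]` to `k[G_a × X] = k[X][T]`. -/
def IsRegularGaAction (φ : Multiplicative k →* (A ≃ₐ[k] A)) : Prop :=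
  ∃ ρ : A →ₐ[k] Polynomial A, ∀ (t : k) (f : A),
    (φ (Multiplicative.ofAdd t))⁻¹ f = (ρ f).eval (algebraMap k A t)

variable (k A) in
/-- The special automorphism group `SAut(X)`: the subgroup of `Aut(X)` generated by the images
of all regular actions of `G_a` on `X`. -/
def SAut : Subgroup (A ≃ₐ[k] A) :=
  Subgroup.closure {g | ∃ φ : Multiplicative k →* (A ≃ₐ[k] A), IsRegularGaAction φ ∧ g ∈ φ.range}

/-- The orbit of the point `x` under the special automorphism group. -/
def sautOrbit (x : A →ₐ[k] k) : Set (A →ₐ[k] k) :=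
  {y | ∃ g ∈ SAut k A, y = act g x}

/-- An isomorphism `θ` from `(k, +)` onto a subgroup `H` of `Aut(X)` makes `H` a `G_a`-subgroup
if the resulting action of `G_a` on `X` is regular. -/
def IsGaSubgroup (H : Subgroup (A ≃ₐ[k] A)) (θ : Multiplicative k ≃* H) : Prop :=
  IsRegularGaAction (H.subtype.comp θ.toMonoidHom)

/-- The value at `t ∈ 𝔸ˢ` of the morphism `𝔸ˢ → X` with comorphism `Ψ`. -/
noncomputable def mapPoint {s : ℕ} (Ψ : A →ₐ[k] MvPolynomial (Fin s) k) (t : Fin s → k) :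
    A →ₐ[k] k :=
  (MvPolynomial.aeval t).comp Ψ

/-- The value at `t ∈ 𝔸¹` of the morphism `𝔸¹ → X` with comorphism `γ`. -/
noncomputable def curvePoint (γ : A →ₐ[k] Polynomial k) (t : k) : A →ₐ[k] k :=
  (Polynomial.aeval t).comp γ

/-- A set `O` of points of `X` is `𝔸¹`-connected if any two points of `O` lie in the image of one
morphism `𝔸¹ → O`. -/
def IsA1Connected (O : Set (A →ₐ[k] k)) : Prop :=
  ∀ x ∈ O, ∀ y ∈ O, ∃ γ : A →ₐ[k] Polynomial k,
    (∀ t : k, curvePoint γ t ∈ O) ∧ (∃ t : k, curvePoint γ t = x) ∧ (∃ t : k, curvePoint γ t = y)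

end Points

/-- `X = Spec A` is unirational over `k` if there is a dominant rational map over `k` from some
affine space `𝔸ⁿ` to `X`. -/
def IsUnirational (k A : Type u) [Field k] [CommRing A] [Algebra k A] : Prop :=
  ∃ (n : ℕ) (f : Scheme.RationalMap (Spec (.of (MvPolynomial (Fin n) k))) (Spec (.of A))),
    f.IsDominant ∧
    f.compHom (Spec.map (CommRingCat.ofHom (algebraMap k A))) =
      Scheme.Hom.toRationalMap
        (Spec.map (CommRingCat.ofHom (algebraMap k (MvPolynomial (Fin n) k))))

end AffVar

/-! A quotient of regular functions fixed by every `exp (t D)` is killed by every locally nilpotent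
`D`, so `FML = k` leaves `SAut(X)` no rational invariants but constants (`div_mem_FML_of_fixed`).
Artin's independence argument over the fixed field then shows that the graphs `{(x, g x)}`, `g ∈
SAut(X)`, are jointly dense in `X × X` (`eq_zero_of_twistedMul_eq_zero`). Each graph family of a
word `φ₁(t₁) ⋯ φₛ(tₛ)` has irreducible closure, and concatenation dominates both words, so by
noetherianity a single word is already dense (`exists_injective_wordGraph`). By Chevalley the image
of that family contains a nonempty open set. A slice over a suitable `x` gives `f ≠ 0` with `D(f)`
covered by `t ↦ φ₁(t₁) ⋯ φₛ(tₛ) x` (`exists_open_subset_of_word`). This map is dominant, hence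
unirationality. The orbit of `x` is the union of the translates of `D(f)`; finitely many suffice,
and prefixing a word that reaches them covers the orbit (`exists_word_surjective`). Lines through
`0` in parameter space give the connecting curves. -/

namespace AffVar

/-! ### Exponentials of locally nilpotent derivations -/

open Polynomial in
/-- The derivation of `A[X]` which acts by `D` on the coefficients and kills `X`. -/
noncomputable def coeffDerivation {k A : Type*} [Field k] [CommRing A] [Algebra k A]
    (D : Derivation k A A) : Derivation k A[X] A[X] :=
  PolynomialModule.equivPolynomialSelf.toLinearMap.compDer D.mapCoeffs

open Polynomial in
@[simp]
theorem coeffDerivation_apply {k A : Type*} [Field k] [CommRing A] [Algebra k A]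
    (D : Derivation k A A) (P : A[X]) (n : ℕ) :
    (coeffDerivation D P).coeff n = D (P.coeff n) :=
  rfl

open Polynomial in
theorem coeffDerivation_C {k A : Type*} [Field k] [CommRing A] [Algebra k A]
    (D : Derivation k A A) (a : A) : coeffDerivation D (C a) = C (D a) := by
  ext n
  simp [coeff_C, apply_ite D]

open Polynomial in
@[simp]
theorem coeffDerivation_X {k A : Type*} [Field k] [CommRing A] [Algebra k A]
    (D : Derivation k A A) : coeffDerivation D (X : A[X]) = 0 := by
  ext n
  simp [coeff_X, apply_ite D]

open Polynomial in
/-- A polynomial which solves the differential equation `P' = D P` is determined by its constant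
coefficient. -/
theorem coeff_eq_of_derivative_eq_coeffDerivation {k A : Type*} [Field k] [CharZero k] [CommRing A]
    [Algebra k A] (D : Derivation k A A) {P : A[X]} (hP : derivative P = coeffDerivation D P) (n : ℕ) :
    P.coeff n = ((n.factorial : k)⁻¹) • (⇑D)^[n] (P.coeff 0) := by
  induction n with
  | zero => simp
  | succ n ih =>
    have h := congrArg (fun Q => Q.coeff n) hP
    simp only [coeff_derivative, coeffDerivation_apply, ih] at h
    rw [Derivation.map_smul, ← Function.iterate_succ_apply' (⇑D)] at h
    have hn : ((n : k) + 1) ≠ 0 := by exact_mod_cast n.succ_ne_zero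
    have h2 : ((n : k) + 1) • P.coeff (n + 1) = P.coeff (n + 1) * ((n : A) + 1) := by
      rw [Algebra.smul_def, mul_comm]; simp
    rw [← h2] at h
    rw [← inv_smul_smul₀ hn (P.coeff (n + 1)), h, smul_smul, Nat.factorial_succ]
    push_cast
    rw [mul_inv]

open Polynomial in
theorem eq_of_derivative_eq_coeffDerivation {k A : Type*} [Field k] [CharZero k] [CommRing A]
    [Algebra k A] (D : Derivation k A A) {P Q : A[X]} (hP : derivative P = coeffDerivation D P)
    (hQ : derivative Q = coeffDerivation D Q) (h : P.coeff 0 = Q.coeff 0) : P = Q := by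
  ext n
  rw [coeff_eq_of_derivative_eq_coeffDerivation D hP, coeff_eq_of_derivative_eq_coeffDerivation D hQ, h]

-- The solution is the exponential series `∑ Dⁱ a / i! Xⁱ`, finite by local nilpotency.
open Polynomial in
theorem exists_flow_polynomial {k A : Type*} [Field k] [CharZero k] [CommRing A]
    [Algebra k A] {D : Derivation k A A} (hD : ∀ a : A, ∃ m : ℕ, (⇑D)^[m] a = 0) (a : A) :
    ∃ P : A[X], derivative P = coeffDerivation D P ∧ P.coeff 0 = a := by
  obtain ⟨m, hm⟩ := hD a
  have hz : ∀ n, m ≤ n → (⇑D)^[n] a = 0 := by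
    intro n hn
    obtain ⟨j, rfl⟩ := Nat.exists_eq_add_of_le' hn
    rw [Function.iterate_add_apply, hm]
    exact iterate_map_zero D j
  have hc : ∀ n, (∑ i ∈ Finset.range m, monomial i (((i.factorial : k)⁻¹) • (⇑D)^[i] a)).coeff n
      = ((n.factorial : k)⁻¹) • (⇑D)^[n] a := by
    intro n
    simp only [finsetSum_coeff, coeff_monomial, Finset.sum_ite_eq', Finset.mem_range]
    split_ifs with h
    · rfl
    · rw [hz n (not_lt.mp h), smul_zero]
  refine ⟨∑ i ∈ Finset.range m, monomial i (((i.factorial : k)⁻¹) • (⇑D)^[i] a), ?_, ?_⟩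
  · ext n
    have hn : ((n : k) + 1) ≠ 0 := by exact_mod_cast n.succ_ne_zero
    have h2 : ∀ b : A, b * ((n : A) + 1) = ((n : k) + 1) • b := by
      intro b
      rw [Algebra.smul_def, mul_comm]; simp
    rw [coeff_derivative, coeffDerivation_apply, hc, hc, Derivation.map_smul,
      ← Function.iterate_succ_apply' (⇑D), h2, smul_smul, Nat.factorial_succ]
    push_cast
    rw [mul_inv, mul_inv_cancel_left₀ hn]
  · rw [hc]; simp

-- Since `D` kills `k`, translating a solution of `P' = D P` by `s` gives another solution; this
-- yields the group law of the flow.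
open Polynomial in
theorem coeffDerivation_taylor {k A : Type*} [Field k] [CommRing A]
    [Algebra k A] (D : Derivation k A A) (s : k) (P : A[X]) :
    coeffDerivation D (taylor (algebraMap k A s) P) = taylor (algebraMap k A s) (coeffDerivation D P) := by
  induction P using Polynomial.induction_on' with
  | add p q hp hq => simp only [map_add, hp, hq]
  | monomial n a =>
    have h : coeffDerivation D (monomial n a) = monomial n (D a) := by
      ext m
      simp [coeff_monomial, apply_ite D]
    rw [h]
    simp [taylor_monomial, Derivation.leibniz, Derivation.leibniz_pow, coeffDerivation_C,
      mul_comm]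

/-- The action `exp (t D)` of `G_a` defined by a locally nilpotent derivation `D`. -/
theorem exists_flow {k A : Type u} [Field k] [CharZero k] [CommRing A]
    [IsDomain A] [Algebra k A] {D : Derivation k A A} (hD : IsLocallyNilpotent D) :
    ∃ (φ : Multiplicative k →* (A ≃ₐ[k] A)) (ρ : A →ₐ[k] Polynomial A),
      (∀ (t : k) (f : A),
        (φ (Multiplicative.ofAdd t))⁻¹ f = (ρ f).eval (algebraMap k A t)) ∧
      (∀ f, (ρ f).coeff 0 = f) ∧ ∀ f, (ρ f).coeff 1 = D f := by
  choose P hP hP0 using exists_flow_polynomial hD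
  have huniq : ∀ (Q : Polynomial A) (a : A), Q.derivative = coeffDerivation D Q → Q.coeff 0 = a →
      P a = Q := fun Q a h1 h2 => eq_of_derivative_eq_coeffDerivation D (hP a) h1 ((hP0 a).trans h2.symm)
  -- Each algebra law holds because both sides solve `P' = D P` with the same constant coefficient.
  let ρ : A →ₐ[k] Polynomial A :=
    { toFun := P
      map_one' := huniq _ _ (by simp) (by simp)
      map_mul' := fun a b => huniq _ _ (by simp [hP, mul_comm]; ring)
        (by simp [Polynomial.mul_coeff_zero, hP0])
      map_zero' := huniq _ _ (by simp) (by simp)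
      map_add' := fun a b => huniq _ _ (by simp [hP]) (by simp [hP0])
      commutes' := fun c => huniq _ _ (by
        rw [Polynomial.algebraMap_apply]; simp [coeffDerivation_C])
        (by rw [Polynomial.algebraMap_apply]; simp) }
  have hρ : ∀ a, ρ a = P a := fun _ => rfl
  let e : k → A →ₐ[k] A := fun t =>
    ((Polynomial.aeval (algebraMap k A t)).restrictScalars k).comp ρ
  have he : ∀ t f, e t f = (P f).eval (algebraMap k A t) := fun t f => by
    simp [e, hρ]
  have hadd : ∀ s t f, e t (e s f) = e (t + s) f := by
    intro s t f
    have h := huniq (Polynomial.taylor (algebraMap k A s) (P f)) (e s f)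
      (by rw [coeffDerivation_taylor, ← hP]; simp [Polynomial.taylor_apply, Polynomial.derivative_comp]) (by
        rw [Polynomial.taylor_coeff_zero, he])
    rw [he, h, Polynomial.taylor_eval, he, map_add]
  have hzero : ∀ f, e 0 f = f := by
    intro f
    rw [he, map_zero, ← Polynomial.coeff_zero_eq_eval_zero, hP0]
  -- The sign makes `(E t)⁻¹` act as `e t`, matching the convention of `IsRegularGaAction`.
  let E : k → (A ≃ₐ[k] A) := fun t => AlgEquiv.ofAlgHom (e (-t)) (e t)
    (by ext f; simp [hadd, hzero]) (by ext f; simp [hadd, hzero])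
  refine ⟨{ toFun := fun t => E t.toAdd
            map_one' := ?_
            map_mul' := ?_ }, ρ, ?_, hP0, ?_⟩
  · ext f
    simp [E, hzero]
  · intro s t
    ext f
    simp [E, hadd, add_comm]
  · intro t f
    exact he t f
  · intro f
    rw [hρ, coeff_eq_of_derivative_eq_coeffDerivation D (hP f), hP0]
    simp

/-- In characteristic zero a nonzero `t` in the kernel has infinitely many multiples, which forces
every `ρ f` to be constant. -/
theorem injective_of_isRegularGaAction {k A : Type u} [Field k] [CharZero k] [CommRing A]
    [IsDomain A] [Algebra k A] {φ : Multiplicative k →* (A ≃ₐ[k] A)} (hφ : IsRegularGaAction φ)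
    (h1 : φ ≠ 1) : Function.Injective φ := by
  rw [injective_iff_map_eq_one]
  intro t ht
  by_contra ht0
  apply h1
  obtain ⟨ρ, hρ⟩ := hφ
  have hconst : ∀ f, ρ f = Polynomial.C f := by
    intro f
    apply Polynomial.eq_of_infinite_eval_eq
    have hinj : Function.Injective (fun n : ℕ => algebraMap k A (n • t.toAdd)) := by
      intro m n hmn
      have := (algebraMap k A).injective hmn
      have ht' : t.toAdd ≠ 0 := ht0
      simpa [ht'] using this
    refine (Set.infinite_range_of_injective hinj).mono ?_
    rintro _ ⟨n, rfl⟩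
    have := hρ (n • t.toAdd) f
    rw [ofAdd_nsmul, ofAdd_toAdd, map_pow, ht, one_pow, inv_one] at this
    simpa using this.symm
  refine MonoidHom.ext fun s => AlgEquiv.ext fun f => ?_
  have h2 := hρ (-s.toAdd) f
  rw [hconst, Polynomial.eval_C, ofAdd_neg, map_inv, inv_inv, ofAdd_toAdd] at h2
  simpa using h2

/-- The data of a faithful regular action of `G_a` on `X`. -/
abbrev GaAction (k A : Type u) [Field k] [CommRing A] [Algebra k A] : Type u :=
  {φ : Multiplicative k →* (A ≃ₐ[k] A) // IsRegularGaAction φ ∧ Function.Injective φ}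

/-! ### Words in one-parameter subgroups -/

section Word

variable {k A : Type u} [Field k] [CommRing A] [Algebra k A]

/-- The product `φ₁(t₁) ⋯ φₛ(tₛ)`. -/
def word {s : ℕ} (φ : Fin s → GaAction k A) (t : Fin s → k) : A ≃ₐ[k] A :=
  (List.ofFn fun i => (φ i).1 (Multiplicative.ofAdd (t i))).prod

theorem word_append {r s : ℕ} (φ : Fin r → GaAction k A) (ψ : Fin s → GaAction k A)
    (t : Fin r → k) (u : Fin s → k) :
    word (Fin.append φ ψ) (Fin.append t u) = word φ t * word ψ u := by
  have : (fun i => (Fin.append φ ψ i).1 (Multiplicative.ofAdd (Fin.append t u i))) =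
      Fin.append (fun i => (φ i).1 (Multiplicative.ofAdd (t i)))
        (fun i => (ψ i).1 (Multiplicative.ofAdd (u i))) := by
    funext i
    refine Fin.addCases (fun i => ?_) (fun i => ?_) i <;> simp
  rw [word, this, List.ofFn_fin_append, List.prod_append]
  rfl

theorem word_zero {s : ℕ} (φ : Fin s → GaAction k A) : word φ 0 = 1 := by
  simp [word]

theorem word_succ {s : ℕ} (φ : Fin (s + 1) → GaAction k A) (t : Fin (s + 1) → k) :
    word φ t = (φ 0).1 (Multiplicative.ofAdd (t 0)) * word (Fin.tail φ) (Fin.tail t) := by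
  simp [word, List.ofFn_succ, Fin.tail]

theorem gaAction_apply_mem_SAut (φ : GaAction k A) (t : Multiplicative k) : φ.1 t ∈ SAut k A :=
  Subgroup.subset_closure ⟨φ.1, φ.2.1, t, rfl⟩

theorem word_mem_SAut {s : ℕ} (φ : Fin s → GaAction k A) (t : Fin s → k) :
    word φ t ∈ SAut k A := by
  apply Subgroup.list_prod_mem
  intro g hg
  obtain ⟨i, rfl⟩ := (List.mem_ofFn' _ _).mp hg
  exact gaAction_apply_mem_SAut _ _

/-- Trivial actions are dropped, so that every letter is faithful and its range is a `G_a`-subgroup.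
-/
theorem exists_word_eq [CharZero k] [IsDomain A] {g : A ≃ₐ[k] A} (hg : g ∈ SAut k A) :
    ∃ (s : ℕ) (φ : Fin s → GaAction k A) (t : Fin s → k), word φ t = g := by
  have hgen : ∀ g : A ≃ₐ[k] A,
      (∃ φ : Multiplicative k →* (A ≃ₐ[k] A), IsRegularGaAction φ ∧ g ∈ φ.range) →
      ∃ (s : ℕ) (φ : Fin s → GaAction k A) (t : Fin s → k), word φ t = g := by
    rintro g ⟨φ, hφ, t, rfl⟩
    by_cases h : φ = 1
    · exact ⟨0, Fin.elim0, Fin.elim0, by simp [word, h]⟩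
    · exact ⟨1, fun _ => ⟨φ, hφ, injective_of_isRegularGaAction hφ h⟩, fun _ => t.toAdd,
        by simp [word]⟩
  induction hg using Subgroup.closure_induction'' with
  | mem g hg => exact hgen g hg
  | inv_mem g hg =>
    obtain ⟨φ, hφ, hg⟩ := hg
    exact hgen _ ⟨φ, hφ, inv_mem hg⟩
  | one => exact ⟨0, Fin.elim0, Fin.elim0, by simp [word]⟩
  | mul g h _ _ ihg ihh =>
    obtain ⟨r, φ, t, rfl⟩ := ihg
    obtain ⟨s, ψ, u, rfl⟩ := ihh
    exact ⟨r + s, Fin.append φ ψ, Fin.append t u, word_append φ ψ t u⟩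

/-- The map `(t, x) ↦ φ₁(t₁) ⋯ φₛ(tₛ) x` is a morphism. -/
theorem exists_word_comorphism {s : ℕ} (φ : Fin s → GaAction k A) :
    ∃ Ψ : A →ₐ[k] MvPolynomial (Fin s) A, ∀ (t : Fin s → k) (f : A),
      MvPolynomial.eval (fun i => algebraMap k A (t i)) (Ψ f) = (word φ t)⁻¹ f := by
  induction s with
  | zero =>
    refine ⟨IsScalarTower.toAlgHom k A _, fun t f => ?_⟩
    simp [word, MvPolynomial.algebraMap_eq]
  | succ s ih =>
    obtain ⟨Ψ, hΨ⟩ := ih (Fin.tail φ)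
    obtain ⟨ρ, hρ⟩ := (φ 0).2.1
    let e : A →ₐ[k] MvPolynomial (Fin (s + 1)) A :=
      ((MvPolynomial.rename Fin.succ).restrictScalars k).comp Ψ
    -- The inverse reverses the product: the first letter acts on `f` through `ρ`, then the tail
    -- acts on the coefficients of `ρ f`.
    refine ⟨(Polynomial.eval₂AlgHom e (MvPolynomial.X 0) fun _ => Commute.all _ _).comp ρ, fun t f => ?_⟩
    rw [word_succ, mul_inv_rev, AlgEquiv.mul_apply, hρ]
    have he : ∀ a, MvPolynomial.eval (fun i => algebraMap k A (t i)) (e a) =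
        (word (Fin.tail φ) (Fin.tail t))⁻¹ a := by
      intro a
      rw [← hΨ]
      simp [e, MvPolynomial.eval_rename, Function.comp_def, Fin.tail]
    rw [AlgHom.comp_apply]
    generalize ρ f = P
    induction P using Polynomial.induction_on' with
    | add P Q hP hQ => rw [map_add, map_add, Polynomial.eval_add, map_add, hP, hQ]
    | monomial n a => simp [he]

end Word

/-! ### Absence of rational invariants and density of the graphs -/

section Descent

variable {k A : Type u} [Field k] [CharZero k] [CommRing A] [IsDomain A] [Algebra k A]

/-- Invariance under `exp (t D)` is a polynomial identity in `t`; its linear coefficient `D a * b =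
a * D b` is the vanishing of the derivative of `a / b`. -/
theorem div_mem_FML_of_fixed {a b : A} (hb : b ≠ 0)
    (h : ∀ g ∈ SAut k A, g a * b = a * g b) :
    algebraMap A (FractionRing A) a / algebraMap A (FractionRing A) b ∈ FML k A := by
  intro D hD E hE
  obtain ⟨φ, ρ, hφ, h0, h1⟩ := exists_flow hD
  have hpoly : ρ a * Polynomial.C b = Polynomial.C a * ρ b := by
    apply Polynomial.eq_of_infinite_eval_eq
    refine (Set.infinite_range_of_injective (algebraMap k A).injective).mono ?_
    rintro _ ⟨t, rfl⟩
    have := h (φ (Multiplicative.ofAdd t))⁻¹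
      (inv_mem (Subgroup.subset_closure ⟨φ, ⟨ρ, hφ⟩, _, rfl⟩))
    simpa [hφ] using this
  have h2 := congrArg (fun P => P.coeff 1) hpoly
  simp only [Polynomial.coeff_mul_C, Polynomial.coeff_C_mul, h1] at h2
  have hb' : algebraMap A (FractionRing A) b ≠ 0 := by simpa using hb
  have h3 := congrArg (algebraMap A (FractionRing A)) h2
  simp only [map_mul] at h3
  rw [E.leibniz_div, hE, hE]
  simp only [smul_eq_mul]
  rw [mul_comm _ (algebraMap A (FractionRing A) (D a)), h3, sub_self, mul_zero]

open TensorProduct in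
/-- The map `a ⊗ b ↦ a g(b)`. -/
noncomputable def twistedMul (g : A →ₐ[k] A) : A ⊗[k] A →ₐ[k] A :=
  Algebra.TensorProduct.productMap (AlgHom.id k A) g

/-- Write `u = ∑ cᵢ ⊗ bᵢ` in a `k`-basis of `A`. The `bᵢ` stay independent over the fixed field,
which is `k`, so the functions `g ↦ g bᵢ` are independent over `K` and all `cᵢ` vanish. -/
theorem eq_zero_of_twistedMul_eq_zero (hFML : FML k A = ⊥) (u : TensorProduct k A A)
    (hu : ∀ g ∈ SAut k A, twistedMul (g : A →ₐ[k] A) u = 0) : u = 0 := by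
  classical
  let K := FractionRing A
  let _ : MulSemiringAction (SAut k A) K := IsFractionRing.mulSemiringAction (SAut k A) A K
  have hsmul : ∀ (g : SAut k A) (a : A), g • algebraMap A K a = algebraMap A K (g.1 a) := by
    intro g a
    exact (algebraMap.coe_smul' g a K).symm
  let B := Module.Basis.ofVectorSpace k A
  have hfix : ∀ x ∈ FixedPoints.subfield (SAut k A) K, ∃ c : k, algebraMap k K c = x := by
    intro x hx
    obtain ⟨a, b, hb, rfl⟩ := IsFractionRing.div_surjective (A := A) x
    have hb0 : b ≠ 0 := nonZeroDivisors.ne_zero hb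
    have hmem : algebraMap A K a / algebraMap A K b ∈ FML k A := by
      refine div_mem_FML_of_fixed hb0 fun g hg => ?_
      have h1 := hx ⟨g, hg⟩
      rw [smul_div₀', hsmul, hsmul, div_eq_div_iff (by simpa using hb0) (by simpa using hb0)] at h1
      apply IsFractionRing.injective A K
      simpa using h1
    rw [hFML, IntermediateField.mem_bot] at hmem
    exact hmem
  let c := TensorProduct.equivFinsuppOfBasisRight (M := A) B u
  have huc : u = c.sum fun i m => m ⊗ₜ B i := by
    rw [← TensorProduct.equivFinsuppOfBasisRight_symm_apply, LinearEquiv.symm_apply_apply]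
  let v := fun i => algebraMap A K (B i)
  have hinj : Function.Injective v :=
    (IsFractionRing.injective A K).comp B.injective
  let s : Finset K := c.support.image v
  have hli : LinearIndepOn (FixedPoints.subfield (SAut k A) K) id (s : Set K) := by
    have hv : LinearIndependent (FixedPoints.subfield (SAut k A) K) v := by
      have hk : LinearIndependent k v :=
        B.linearIndependent.map' (IsScalarTower.toAlgHom k A K).toLinearMap
          (LinearMap.ker_eq_bot.mpr (IsFractionRing.injective A K))
      rw [linearIndependent_iff'] at hk ⊢
      intro r g hg i hi
      choose d hd using fun i => hfix (g i) (g i).2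
      have hdi := hk r d (by
        rw [← hg]
        refine Finset.sum_congr rfl fun j _ => ?_
        rw [Algebra.smul_def, hd]
        rfl) i hi
      ext
      rw [← hd, hdi, map_zero]
      rfl
    refine hv.linearIndepOn_id.mono ?_
    simp only [s, Finset.coe_image]
    exact Set.image_subset_range v _
  have hlin := FixedPoints.linearIndependent_smul_of_linearIndependent (SAut k A) K hli
  have : Nonempty (Module.Basis.ofVectorSpaceIndex k A) := B.index_nonempty
  have hzero : ∀ i ∈ c.support, c i = 0 := by
    intro i hi
    have h := linearIndepOn_finset_iff.mp hlin
      -- The independent family is indexed by the elements `v i` of `K` themselves; `invFun v`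
      -- recovers the index.
      (fun x => algebraMap A K (c (Function.invFun v x))) ?_ (v i) (Finset.mem_image_of_mem v hi)
    · rw [Function.leftInverse_invFun hinj] at h
      exact IsFractionRing.injective A K (h.trans (map_zero _).symm)
    · funext g
      rw [Finset.sum_image hinj.injOn, Finset.sum_apply]
      have h1 := congrArg (algebraMap A K) (hu g.1 g.2)
      rw [huc, map_zero, Finsupp.sum, map_sum, map_sum] at h1
      rw [Pi.zero_apply, ← h1]
      refine Finset.sum_congr rfl fun j _ => ?_
      rw [Function.leftInverse_invFun hinj]
      simp [twistedMul, v, hsmul, MulAction.toFun_apply]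
  have hc : c = 0 := by
    ext i
    by_contra h
    exact h (hzero i (Finsupp.mem_support_iff.mpr h))
  rw [huc, hc, Finsupp.sum_zero_index]

end Descent

/-! ### A single word with dense graph family -/

section MinimalWord

variable {k A : Type u} [Field k] [CommRing A] [Algebra k A]

/-- The comorphism of the map `(t, x) ↦ φ₁(t₁) ⋯ φₛ(tₛ) x`. -/
noncomputable def wordComorphism {s : ℕ} (φ : Fin s → GaAction k A) :
    A →ₐ[k] MvPolynomial (Fin s) A :=
  (exists_word_comorphism φ).choose

theorem eval_wordComorphism {s : ℕ} (φ : Fin s → GaAction k A) (t : Fin s → k) (f : A) :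
    MvPolynomial.eval (fun i => algebraMap k A (t i)) (wordComorphism φ f) = (word φ t)⁻¹ f :=
  (exists_word_comorphism φ).choose_spec t f

open TensorProduct in
/-- The comorphism of the map `(t, x) ↦ (x, φ₁(t₁) ⋯ φₛ(tₛ) x)`. -/
noncomputable def wordGraph {s : ℕ} (φ : Fin s → GaAction k A) :
    A ⊗[k] A →ₐ[k] MvPolynomial (Fin s) A :=
  Algebra.TensorProduct.productMap (IsScalarTower.toAlgHom k A _) (wordComorphism φ)

theorem eval_wordGraph {s : ℕ} (φ : Fin s → GaAction k A) (t : Fin s → k)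
    (u : TensorProduct k A A) :
    MvPolynomial.eval (fun i => algebraMap k A (t i)) (wordGraph φ u) =
      twistedMul (((word φ t)⁻¹ : A ≃ₐ[k] A) : A →ₐ[k] A) u := by
  induction u using TensorProduct.induction_on with
  | zero => simp
  | add u v hu hv => rw [map_add, map_add, map_add, hu, hv]
  | tmul a b =>
    simp [wordGraph, twistedMul, eval_wordComorphism, MvPolynomial.algebraMap_eq]

variable [CharZero k] [IsDomain A]

theorem wordGraph_eq_zero_iff {s : ℕ} (φ : Fin s → GaAction k A) (u : TensorProduct k A A) :
    wordGraph φ u = 0 ↔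
      ∀ t, twistedMul (((word φ t)⁻¹ : A ≃ₐ[k] A) : A →ₐ[k] A) u = 0 := by
  refine ⟨fun h t => by rw [← eval_wordGraph, h, map_zero], fun h => ?_⟩
  refine MvPolynomial.funext_set (fun _ => Set.range (algebraMap k A))
    (fun _ => Set.infinite_range_of_injective (algebraMap k A).injective) fun x hx => ?_
  choose t ht using fun i => hx i trivial
  obtain rfl : (fun i => algebraMap k A (t i)) = x := funext ht
  rw [eval_wordGraph, h, map_zero]

/-- The kernels are primes of a noetherian ring. One of least height lies in every other kernel,
hence is killed by all of `SAut(X)` and is zero. -/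
theorem exists_injective_wordGraph [Algebra.FiniteType k A] (hFML : FML k A = ⊥) :
    ∃ (s : ℕ) (φ : Fin s → GaAction k A), Function.Injective (wordGraph φ) := by
  let I : (Σ s : ℕ, Fin s → GaAction k A) → Ideal (TensorProduct k A A) :=
    fun w => RingHom.ker (wordGraph w.2)
  have : Algebra.FiniteType k (TensorProduct k A A) :=
    Algebra.FiniteType.trans (S := A) ‹_› inferInstance
  have : IsNoetherianRing (TensorProduct k A A) := Algebra.FiniteType.isNoetherianRing k _
  have hprime : ∀ w, (I w).IsPrime := fun w => RingHom.ker_isPrime _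
  have : Nonempty (Σ s : ℕ, Fin s → GaAction k A) := ⟨⟨0, Fin.elim0⟩⟩
  let w := Function.argmin fun w => (I w).height
  refine ⟨w.1, w.2, (injective_iff_map_eq_zero _).mpr fun u hu => ?_⟩
  -- Setting either block of parameters to `0` puts the kernel of the concatenated word inside both
  -- kernels; minimal height turns the first inclusion into equality.
  have hle : ∀ w', I w ≤ I w' := by
    intro w'
    let v : Σ s : ℕ, Fin s → GaAction k A := ⟨w.1 + w'.1, Fin.append w.2 w'.2⟩
    have hv : ∀ x, x ∈ I v ↔ ∀ t t', twistedMul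
        (((word w.2 t * word w'.2 t')⁻¹ : A ≃ₐ[k] A) : A →ₐ[k] A) x = 0 := by
      intro x
      refine (wordGraph_eq_zero_iff _ x).trans ⟨fun h t t' => ?_, fun h t => ?_⟩
      · rw [← word_append]
        exact h _
      · rw [← Fin.append_castAdd_natAdd (f := t), word_append]
        exact h _ _
    have h1 : I v ≤ I w := fun x hx => (wordGraph_eq_zero_iff _ x).mpr fun t => by
      simpa [word_zero] using (hv x).mp hx t 0
    have h2 : I v ≤ I w' := fun x hx => (wordGraph_eq_zero_iff _ x).mpr fun t => by
      simpa [word_zero] using (hv x).mp hx 0 t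
    have h3 : I v = I w := by
      by_contra h
      exact (Function.not_lt_argmin (fun w => (I w).height) v)
        (Ideal.height_strict_mono_of_isPrime_of_isPrime (lt_of_le_of_ne h1 h))
    exact h3 ▸ h2
  refine eq_zero_of_twistedMul_eq_zero hFML u fun g hg => ?_
  obtain ⟨s, φ, t, ht⟩ := exists_word_eq (inv_mem hg)
  have := (wordGraph_eq_zero_iff φ u).mp (hle ⟨s, φ⟩ hu) t
  rwa [ht, inv_inv] at this

end MinimalWord

/-! ### Points and images of dominant morphisms -/

section Chevalley

variable {k B C : Type*} [Field k] [IsAlgClosed k] [CommRing B] [Algebra k B] [CommRing C]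
  [Algebra k C] [Algebra.FiniteType k C]

/-- Nullstellensatz: a proper ideal of a finitely generated algebra over an algebraically closed
field vanishes at some point. -/
theorem exists_point_of_ne_top {I : Ideal C} (hI : I ≠ ⊤) :
    ∃ z : C →ₐ[k] k, ∀ c ∈ I, z c = 0 := by
  obtain ⟨m, hm, hIm⟩ := Ideal.exists_le_maximal I hI
  let _ : Field (C ⧸ m) := Ideal.Quotient.field m
  have : Module.Finite k (C ⧸ m) := finite_of_finite_type_of_isJacobsonRing k (C ⧸ m)
  let e : k ≃ₐ[k] C ⧸ m := AlgEquiv.ofBijective (Algebra.ofId k _)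
    (IsAlgClosed.algebraMap_bijective_of_isIntegral)
  refine ⟨(e.symm : C ⧸ m →ₐ[k] k).comp (Ideal.Quotient.mkₐ k m), fun c hc => ?_⟩
  have : Ideal.Quotient.mkₐ k m c = 0 := Ideal.Quotient.eq_zero_iff_mem.mpr (hIm hc)
  rw [AlgHom.comp_apply, this, map_zero]

/-- A finitely generated algebra is Jacobson, so in a domain some maximal ideal avoids `h`. -/
theorem exists_point_ne_zero [IsDomain C] {h : C} (hh : h ≠ 0) : ∃ z : C →ₐ[k] k, z h ≠ 0 := by
  have : IsJacobsonRing C := isJacobsonRing_of_finiteType (A := k)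
  have hj : h ∉ Ideal.jacobson (⊥ : Ideal C) := by
    rw [IsJacobsonRing.out ‹_› Ideal.isRadical_bot]
    simpa using hh
  rw [Ideal.jacobson, Ideal.mem_sInf] at hj
  push Not at hj
  obtain ⟨m, ⟨-, hm⟩, hhm⟩ := hj
  obtain ⟨z, hz⟩ := exists_point_of_ne_top (k := k) hm.ne_top
  refine ⟨z, fun h0 => hhm ?_⟩
  have hker : m = RingHom.ker z := hm.eq_of_le (RingHom.ker_ne_top _) hz
  rw [hker]
  exact h0

/-- A dominant morphism of irreducible affine varieties contains a nonempty open set in its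
image. -/
theorem exists_lift_of_injective [IsDomain C] [IsNoetherianRing B]
    (j : B →ₐ[k] C) (hj : Function.Injective j) :
    ∃ h : B, h ≠ 0 ∧ ∀ y : B →ₐ[k] k, y h ≠ 0 → ∃ z : C →ₐ[k] k, z.comp j = y := by
  have hfin : (j : B →+* C).FinitePresentation := by
    refine RingHom.FinitePresentation.of_finiteType.mp ?_
    refine RingHom.FiniteType.of_comp_finiteType (f := algebraMap k B) ?_
    rw [AlgHom.comp_algebraMap]
    exact RingHom.finiteType_algebraMap.mpr ‹_›
  obtain ⟨S, hS⟩ := PrimeSpectrum.exists_constructibleSetData_iff.mpr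
    (PrimeSpectrum.isConstructible_range_comap hfin)
  have : IsDomain B := hj.isDomain j
  -- The generic point lies in the image. The locally closed piece containing it has only zero
  -- equations, so it is the basic open set of `D.f`.
  have hgen : (⊥ : PrimeSpectrum B) ∈ S.toSet := by
    rw [hS]
    refine ⟨⊥, ?_⟩
    ext x
    simpa using map_eq_zero_iff j hj
  obtain ⟨D, hD, hgD, hfD⟩ := Set.mem_iUnion₂.mp hgen
  refine ⟨D.f, fun h0 => hfD (by simp [h0]), fun y hy => ?_⟩
  have hyS : (⟨RingHom.ker y, RingHom.ker_isPrime y⟩ : PrimeSpectrum B) ∈ S.toSet := by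
    refine Set.mem_iUnion₂.mpr ⟨D, hD, ?_, fun h => hy (h rfl)⟩
    rintro b hb
    have hb0 : b = 0 := by simpa using hgD hb
    rw [hb0]
    exact zero_mem _
  rw [hS] at hyS
  obtain ⟨q, hq⟩ := hyS
  -- A prime over `ker y` makes the fibre nonempty; the Nullstellensatz then supplies a `k`-point of
  -- it.
  have hle : (RingHom.ker y).map (j : B →+* C) ≤ q.asIdeal := by
    rw [Ideal.map_le_iff_le_comap]
    exact (congrArg PrimeSpectrum.asIdeal hq).ge
  obtain ⟨z, hz⟩ := exists_point_of_ne_top (k := k) (ne_top_of_le_ne_top q.isPrime.ne_top hle)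
  refine ⟨z, AlgHom.ext fun b => ?_⟩
  have hb : b - algebraMap k B (y b) ∈ RingHom.ker y := by simp [RingHom.mem_ker]
  have := hz _ (Ideal.mem_map_of_mem (j : B →+* C) hb)
  simpa [sub_eq_zero] using this

end Chevalley

/-! ### Unirationality from an injective comorphism -/

section Unirational

open AlgebraicGeometry CategoryTheory

theorem isUnirational_of_injective {k A : Type u} [Field k] [CommRing A] [Algebra k A] {n : ℕ}
    (Ψ : A →ₐ[k] MvPolynomial (Fin n) k) (hΨ : Function.Injective Ψ) : IsUnirational k A := by
  have hdom : IsDominant (Spec.map (CommRingCat.ofHom (Ψ : A →+* MvPolynomial (Fin n) k))) := by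
    refine ⟨(PrimeSpectrum.denseRange_comap_iff_ker_le_nilRadical _).mpr ?_⟩
    intro a ha
    rw [(map_eq_zero_iff Ψ hΨ).mp ha]
    exact zero_mem _
  refine ⟨n, Scheme.Hom.toRationalMap
    (Spec.map (CommRingCat.ofHom (Ψ : A →+* MvPolynomial (Fin n) k))), ?_, ?_⟩
  · unfold Scheme.Hom.toRationalMap
    infer_instance
  · unfold Scheme.Hom.toRationalMap
    rw [← Scheme.RationalMap.compHom_toRationalMap, Scheme.Hom.toPartialMap_compHom,
      ← Spec.map_comp, ← CommRingCat.ofHom_comp, AlgHom.comp_algebraMap]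

end Unirational

/-! ### The orbit: connectedness, openness, parametrization -/

section Orbit

variable {k A : Type u} [Field k] [CommRing A] [Algebra k A]

theorem act_mul (g h : A ≃ₐ[k] A) (x : A →ₐ[k] k) : act (g * h) x = act g (act h x) := by
  ext f
  simp [act]

theorem act_one (x : A →ₐ[k] k) : act 1 x = x := by
  ext f
  simp [act]

theorem act_apply (g : A ≃ₐ[k] A) (x : A →ₐ[k] k) (f : A) : act g x f = x (g⁻¹ f) :=
  rfl

/-- The comorphism of the map `t ↦ φ₁(t₁) ⋯ φₛ(tₛ) x`. -/
noncomputable def orbitComorphism {s : ℕ} (φ : Fin s → GaAction k A) (x : A →ₐ[k] k) :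
    A →ₐ[k] MvPolynomial (Fin s) k :=
  (MvPolynomial.mapAlgHom x).comp (wordComorphism φ)

theorem mapPoint_orbitComorphism {s : ℕ} (φ : Fin s → GaAction k A) (x : A →ₐ[k] k)
    (t : Fin s → k) : mapPoint (orbitComorphism φ x) t = act (word φ t) x := by
  ext f
  rw [act_apply, ← eval_wordComorphism]
  simp only [mapPoint, orbitComorphism, AlgHom.comp_apply]
  generalize wordComorphism φ f = P
  induction P using MvPolynomial.induction_on with
  | C a => simp
  | add P Q hP hQ => simp only [map_add, hP, hQ]
  | mul_X P i hP =>
    simp only [map_mul, hP]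
    simp

theorem isA1Connected_sautOrbit [CharZero k] [IsDomain A] (x : A →ₐ[k] k) :
    IsA1Connected (sautOrbit x) := by
  rintro _ ⟨g, hg, rfl⟩ _ ⟨h, hh, rfl⟩
  obtain ⟨s, φ, t, ht⟩ := exists_word_eq (mul_mem hh (inv_mem hg))
  -- The line `τ ↦ τ t` runs from the trivial word to the word equal to `h g⁻¹`.
  let γ : A →ₐ[k] Polynomial k :=
    (MvPolynomial.aeval fun i => Polynomial.C (t i) * Polynomial.X).comp
      (orbitComorphism φ (act g x))
  have hγ : ∀ τ, curvePoint γ τ = act (word φ (τ • t)) (act g x) := by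
    intro τ
    rw [← mapPoint_orbitComorphism]
    have hcomp : (Polynomial.aeval τ).comp
        (MvPolynomial.aeval fun i => Polynomial.C (t i) * Polynomial.X) =
        MvPolynomial.aeval (R := k) (τ • t) := by
      ext i
      rw [AlgHom.comp_apply, MvPolynomial.aeval_X, MvPolynomial.aeval_X, map_mul,
        Polynomial.aeval_C, Polynomial.aeval_X, mul_comm]
      rfl
    exact AlgHom.ext fun f => DFunLike.congr_fun hcomp _
  refine ⟨γ, fun τ => ?_, ⟨0, ?_⟩, ⟨1, ?_⟩⟩
  · exact ⟨word φ (τ • t) * g, mul_mem (word_mem_SAut _ _) hg, by rw [hγ, act_mul]⟩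
  · rw [hγ, zero_smul, word_zero, act_one]
  · rw [hγ, one_smul, ht, ← act_mul, inv_mul_cancel_right]

variable [IsDomain A]

theorem exists_word_eq_of_finset [CharZero k] (F : Finset (A ≃ₐ[k] A)) (hF : ∀ g ∈ F, g ∈ SAut k A) :
    ∃ (s : ℕ) (φ : Fin s → GaAction k A), ∀ g ∈ F, ∃ t, word φ t = g := by
  classical
  induction F using Finset.induction_on with
  | empty => exact ⟨0, Fin.elim0, by simp⟩
  | insert g F _ ih =>
    obtain ⟨r, φ, hφ⟩ := ih fun h hh => hF h (Finset.mem_insert_of_mem hh)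
    obtain ⟨s, ψ, u, hu⟩ := exists_word_eq (hF g (Finset.mem_insert_self g F))
    refine ⟨r + s, Fin.append φ ψ, fun h hh => ?_⟩
    obtain rfl | hh := Finset.mem_insert.mp hh
    · exact ⟨Fin.append 0 u, by rw [word_append, word_zero, one_mul, hu]⟩
    · obtain ⟨t, ht⟩ := hφ h hh
      exact ⟨Fin.append t 0, by rw [word_append, word_zero, mul_one, ht]⟩

variable [Algebra.FiniteType k A]

theorem exists_open_subset_of_word [CharZero k] [IsAlgClosed k] (hFML : FML k A = ⊥) :
    ∃ (s : ℕ) (φ : Fin s → GaAction k A) (x : A →ₐ[k] k) (f : A), f ≠ 0 ∧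
      ∀ y : A →ₐ[k] k, y f ≠ 0 → ∃ t, y = act (word φ t) x := by
  obtain ⟨s, φ, hφ⟩ := exists_injective_wordGraph hFML
  have : Algebra.FiniteType k (TensorProduct k A A) :=
    Algebra.FiniteType.trans (S := A) ‹_› inferInstance
  have : Algebra.FiniteType k (MvPolynomial (Fin s) A) :=
    Algebra.FiniteType.trans (S := A) ‹_› inferInstance
  have : IsNoetherianRing (TensorProduct k A A) := Algebra.FiniteType.isNoetherianRing k _
  have : IsDomain (TensorProduct k A A) := hφ.isDomain (wordGraph φ)
  obtain ⟨h, hh, hlift⟩ := exists_lift_of_injective (wordGraph φ) hφ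
  obtain ⟨z, hz⟩ := exists_point_ne_zero (k := k) hh
  let x : A →ₐ[k] k := z.comp Algebra.TensorProduct.includeLeft
  -- This is `h` restricted to the slice `{x} × X`; it is nonzero because `h` does not vanish at
  -- `z`, whose first component is `x`.
  let f : A := Algebra.TensorProduct.productMap ((Algebra.ofId k A).comp x) (AlgHom.id k A) h
  have hf : ∀ y : A →ₐ[k] k, y f = Algebra.TensorProduct.productMap x y h := by
    intro y
    rw [← AlgHom.comp_apply]
    congr 1
    ext a <;> simp
  refine ⟨s, φ, x, f, fun h0 => hz ?_, fun y hy => ?_⟩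
  · have h1 := hf (z.comp Algebra.TensorProduct.includeRight)
    rw [h0, map_zero] at h1
    rw [h1]
    congr 1
    ext a <;> simp [x, ← Algebra.TensorProduct.one_def]
  · rw [hf] at hy
    obtain ⟨w, hw⟩ := hlift _ hy
    refine ⟨fun i => w (MvPolynomial.X i), AlgHom.ext fun a => ?_⟩
    have hwC : ∀ a, w (MvPolynomial.C a) = x a := by
      intro a
      have := DFunLike.congr_fun hw (a ⊗ₜ 1)
      simpa [wordGraph, MvPolynomial.algebraMap_eq] using this
    have hwa : w (wordComorphism φ a) = y a := by
      have := DFunLike.congr_fun hw (1 ⊗ₜ a)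
      simpa [wordGraph] using this
    rw [← hwa, act_apply, ← eval_wordComorphism]
    generalize wordComorphism φ a = P
    induction P using MvPolynomial.induction_on with
    | C a => simp [hwC]
    | add P Q hP hQ => simp only [map_add, hP, hQ]
    | mul_X P i hP =>
      simp only [map_mul, hP]
      simp

/-- A function in the kernel vanishes on the image, hence on the dense set `D(f)`. -/
theorem orbitComorphism_injective [IsAlgClosed k] {s : ℕ} {φ : Fin s → GaAction k A}
    {x : A →ₐ[k] k} {f : A} (hf : f ≠ 0)
    (h : ∀ y : A →ₐ[k] k, y f ≠ 0 → ∃ t, y = act (word φ t) x) :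
    Function.Injective (orbitComorphism φ x) := by
  refine (injective_iff_map_eq_zero _).mpr fun a ha => ?_
  by_contra ha0
  obtain ⟨y, hy⟩ := exists_point_ne_zero (k := k) (mul_ne_zero ha0 hf)
  rw [map_mul] at hy
  obtain ⟨t, rfl⟩ := h y (right_ne_zero_of_mul hy)
  apply left_ne_zero_of_mul hy
  rw [← mapPoint_orbitComorphism, mapPoint, AlgHom.comp_apply, ha, map_zero]

/-- Since `D(f)` is a nonempty subset of the orbit, its translates cover the orbit and stay inside
it. -/
theorem mem_sautOrbit_iff [IsAlgClosed k] {s : ℕ} {φ : Fin s → GaAction k A}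
    {x : A →ₐ[k] k} {f : A} (hf : f ≠ 0)
    (h : ∀ y : A →ₐ[k] k, y f ≠ 0 → ∃ t, y = act (word φ t) x) (y : A →ₐ[k] k) :
    y ∈ sautOrbit x ↔ ∃ g ∈ SAut k A, y (g f) ≠ 0 := by
  constructor
  · rintro ⟨g, hg, rfl⟩
    obtain ⟨y₀, hy₀⟩ := exists_point_ne_zero (k := k) hf
    obtain ⟨t, rfl⟩ := h y₀ hy₀
    refine ⟨g * (word φ t)⁻¹, mul_mem hg (inv_mem (word_mem_SAut φ t)), ?_⟩
    simpa [act_apply] using hy₀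
  · rintro ⟨g, hg, hy⟩
    obtain ⟨t, ht⟩ := h (act g⁻¹ y) (by simpa [act_apply] using hy)
    refine ⟨g * word φ t, mul_mem hg (word_mem_SAut φ t), ?_⟩
    rw [act_mul, ← ht, ← act_mul, mul_inv_cancel, act_one]

theorem exists_word_surjective [CharZero k] [IsAlgClosed k] {s : ℕ} {φ : Fin s → GaAction k A}
    {x : A →ₐ[k] k} {f : A} (hf : f ≠ 0)
    (h : ∀ y : A →ₐ[k] k, y f ≠ 0 → ∃ t, y = act (word φ t) x) :
    ∃ (r : ℕ) (ψ : Fin r → GaAction k A), ∀ y ∈ sautOrbit x, ∃ t, y = act (word ψ t) x := by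
  classical
  have : IsNoetherianRing A := Algebra.FiniteType.isNoetherianRing k A
  let T : Set A := (fun g : A ≃ₐ[k] A => g f) '' SAut k A
  -- The ideal generated by all translates of `f` is generated by finitely many, so finitely many
  -- translates of `D(f)` cover the orbit.
  obtain ⟨F, hFT, hF⟩ := Submodule.fg_span_iff_fg_span_finset_subset T |>.mp
    (IsNoetherian.noetherian (Submodule.span A T))
  obtain ⟨G, hG, rfl⟩ := Finset.subset_set_image_iff.mp hFT
  obtain ⟨r, ψ, hψ⟩ := exists_word_eq_of_finset G fun g hg => hG hg
  refine ⟨r + s, Fin.append ψ φ, fun y hy => ?_⟩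
  obtain ⟨g, hg, hgy⟩ := (mem_sautOrbit_iff hf h y).mp hy
  obtain ⟨g', hg', hgy'⟩ : ∃ g' ∈ G, y (g' f) ≠ 0 := by
    by_contra! hcon
    have hle : Submodule.span A T ≤ RingHom.ker y := by
      rw [hF, Submodule.span_le]
      intro a ha
      obtain ⟨g', hg', rfl⟩ := Finset.mem_image.mp ha
      exact hcon g' hg'
    exact hgy (hle (Submodule.subset_span ⟨g, hg, rfl⟩))
  obtain ⟨u, rfl⟩ := hψ g' hg'
  obtain ⟨t, ht⟩ := h (act (word ψ u)⁻¹ y) (by simpa [act_apply] using hgy')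
  refine ⟨Fin.append u t, ?_⟩
  rw [word_append, act_mul, ← ht, ← act_mul, mul_inv_cancel, act_one]

end Orbit

end AffVar

/-! ### Assembly -/

theorem mainTheorem3 (k : Type u) [Field k] [IsAlgClosed k] [CharZero k]
    (A : Type u) [CommRing A] [IsDomain A] [Algebra k A] [Algebra.FiniteType k A]
    (hFML : AffVar.FML k A = ⊥) :
    AffVar.IsUnirational k A ∧
    ∃ (x : A →ₐ[k] k) (O : Set (A →ₐ[k] k)),
      O = AffVar.sautOrbit x ∧
      AffVar.IsZariskiOpen O ∧
      (∃ (s : ℕ) (H : Fin s → Subgroup (A ≃ₐ[k] A)) (θ : ∀ i, Multiplicative k ≃* H i),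
        (∀ i, AffVar.IsGaSubgroup (H i) (θ i)) ∧
        O = {y | ∃ h : ∀ i, H i, y = AffVar.act (List.ofFn fun i => (h i : A ≃ₐ[k] A)).prod x} ∧
        ∃ Ψ : A →ₐ[k] MvPolynomial (Fin s) k, ∀ t : Fin s → k,
          AffVar.mapPoint Ψ t =
            AffVar.act
              (List.ofFn fun i => (θ i (Multiplicative.ofAdd (t i)) : A ≃ₐ[k] A)).prod x) ∧
      AffVar.IsA1Connected O := by
  obtain ⟨s, φ, x, f, hf, h⟩ := AffVar.exists_open_subset_of_word hFML
  obtain ⟨r, ψ, hψ⟩ := AffVar.exists_word_surjective hf h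
  refine ⟨AffVar.isUnirational_of_injective _ (AffVar.orbitComorphism_injective hf h), x,
    AffVar.sautOrbit x, rfl, ⟨(fun g : A ≃ₐ[k] A => g f) '' AffVar.SAut k A, ?_⟩,
    ⟨r, fun i => (ψ i).1.range, fun i => MonoidHom.ofInjective (ψ i).2.2, fun i => (ψ i).2.1,
      ?_, AffVar.orbitComorphism ψ x, AffVar.mapPoint_orbitComorphism ψ x⟩,
    AffVar.isA1Connected_sautOrbit x⟩
  · ext y
    simpa using AffVar.mem_sautOrbit_iff hf h y
  · ext y
    constructor
    · intro hy
      obtain ⟨t, rfl⟩ := hψ y hy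
      exact ⟨fun i => MonoidHom.ofInjective (ψ i).2.2 (Multiplicative.ofAdd (t i)), rfl⟩
    · rintro ⟨g, rfl⟩
      refine ⟨_, ?_, rfl⟩
      refine Subgroup.list_prod_mem _ fun a ha => ?_
      obtain ⟨i, rfl⟩ := (List.mem_ofFn' _ _).mp ha
      obtain ⟨t, ht⟩ := (g i).2
      have := AffVar.gaAction_apply_mem_SAut (ψ i) t
      rwa [ht] at this
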